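/- Let $E$ be a finite set. For a matroid $\mathsf M$ on $E$ let $\mathscr P(\mathsf M)=\operatorname{conv}\{e_B : B \text{ a basis of } \mathsf M\}\subseteq\mathbb R^E$, where $e_B=\sum_{i\in B}e_i$, be its base polytope, and let $\mathfrak M_E=\{\mathscr P(\mathsf M):\mathsf M\text{ a matroid on }E\}$; a matroid is identified with its base polytope. Let $\mathbb I_{\mathfrak M_E}$ be the group of all finite integer combinations of the indicator functions $\mathbb 1_{\mathscr P}:\mathbb R^E\to\mathbb Z$ of the polytopes $\mathscr P\in\mathfrak M_E$. A map $f:\mathfrak M_E\to A$ to an abelian group $A$ is called a (strong) valuation if there is a homomorphism of abelian groups $\widehat f:\mathbb I_{\mathfrak M_E}\to A$ with $f(\mathscr P)=\widehat f(\mathbb 1_{\mathscr P})$ for all $\mathscr P\in\mathfrak M_E$. Let $m\ge 0$ and let $F_0\subsetneq F_1\subsetneq\cdots\subsetneq F_m\subsetneq E$ be a fixed flag of subsets. Then the map $\widehat{\phi}_{F_0,\ldots,F_m}:\mathfrak M_E\to\mathbb Q$ with $$\widehat{\phi}_{F_0,\ldots,F_m}(\mathsf M)=\begin{cases}1&\text{if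 } F_i \text{ is a flat of } \mathsf M \text{ for all } 0\le i\le m,\\0&\text{otherwise}\end{cases}$$ is a valuation. Moreover, for every integer vector $(r_0,\ldots,r_m)$, the map $\phi:\mathfrak M_E\to\mathbb Q$ with $$\phi(\mathsf M)=\begin{cases}1&\text{if } F_i \text{ is a flat of } \mathsf M \text{ and } \operatorname{rk}_{\mathsf M}(F_i)=r_i \text{ for all } 0\le i\le m,\\0&\text{otherwise}\end{cases}$$ is a valuation. -/

import Mathlib

noncomputable section

namespace MatroidValuation

/-- The 0/1-vector `e_B = ∑_{i ∈ B} e_i` in `ℝ^E`. -/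
def vec {E : Type*} (B : Set E) : E → ℝ := B.indicator 1

/-- The matroids with ground set (all of) `E`. -/
abbrev MatroidOn (E : Type*) : Type _ := {M : Matroid E // M.E = Set.univ}

/-- The base polytope `𝒫(M)`: the convex hull of the vectors `e_B`, `B` a basis of `M`. -/
def basePolytope {E : Type*} (M : Matroid E) : Set (E → ℝ) :=
  convexHull ℝ (vec '' {B | M.IsBase B})

/-- The family `𝔐_E` of all base polytopes of matroids on `E`. -/
def matroidPolytopes (E : Type*) : Set (Set (E → ℝ)) :=
  Set.range fun M : MatroidOn E => basePolytope M.1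

/-- The indicator function `ℝ^E → ℤ` of a subset of `ℝ^E`. -/
def indicatorFun {E : Type*} (P : Set (E → ℝ)) : (E → ℝ) → ℤ := P.indicator 1

/-- The indicator subgroup `𝕀_𝔓` of a family `𝔓` of polytopes: the group of all
finite integer combinations of the indicator functions of the members of `𝔓`. -/
def indicatorSubgroup {E : Type*} (𝔓 : Set (Set (E → ℝ))) : AddSubgroup ((E → ℝ) → ℤ) :=
  AddSubgroup.closure (indicatorFun '' 𝔓)

/-- The map `𝔓 → 𝕀_𝔓` sending a polytope to its indicator function. -/
def toIndicator {E : Type*} (𝔓 : Set (Set (E → ℝ))) (P : 𝔓) : indicatorSubgroup 𝔓 :=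
  ⟨indicatorFun P.1, AddSubgroup.subset_closure ⟨P.1, P.2, rfl⟩⟩

/-- A (strong) valuation on a family `𝔓` of polytopes: a map into an abelian group that
factors through the indicator map by a homomorphism of abelian groups `𝕀_𝔓 → A`. -/
def IsValuation {E : Type*} {A : Type*} [AddCommGroup A] (𝔓 : Set (Set (E → ℝ)))
    (f : 𝔓 → A) : Prop :=
  ∃ g : indicatorSubgroup 𝔓 →+ A, ∀ P : 𝔓, f P = g (toIndicator 𝔓 P)

/-- A set is a basis exactly if its 0/1-vector lies in the base polytope. -/
theorem vec_mem_basePolytope_iff {E : Type*} [Finite E] (M : Matroid E) (B : Set E) :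
    vec B ∈ basePolytope M ↔ M.IsBase B := by
  classical
  have := Fintype.ofFinite E
  refine ⟨fun h => ?_, fun h => subset_convexHull ℝ _ ⟨B, h, rfl⟩⟩
  by_contra hB
  -- the linear functional whose strict maximum on the cube is attained at `vec B`
  let l : (E → ℝ) →ₗ[ℝ] ℝ := ∑ i, (if i ∈ B then (1 : ℝ) else -1) • LinearMap.proj i
  have hl : ∀ x, l x = ∑ i, (if i ∈ B then (1 : ℝ) else -1) * x i := fun x => by
    simp only [l, LinearMap.sum_apply, LinearMap.smul_apply, LinearMap.proj_apply, smul_eq_mul]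
  have hsub : vec '' {B' | M.IsBase B'} ⊆ {x | l x < l (vec B)} := by
    rintro _ ⟨B', hB', rfl⟩
    have hne : B' ≠ B := fun h => hB (h ▸ hB')
    change l (vec B') < l (vec B)
    rw [hl, hl]
    have hle : ∀ i, (if i ∈ B then (1 : ℝ) else -1) * vec B' i ≤
        (if i ∈ B then (1 : ℝ) else -1) * vec B i := by
      intro i
      by_cases h1 : i ∈ B <;> by_cases h2 : i ∈ B' <;> simp [vec, h1, h2]
    obtain ⟨i, hi⟩ : ∃ i, ¬ (i ∈ B' ↔ i ∈ B) := by
      by_contra hcon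
      push Not at hcon
      exact hne (Set.ext hcon)
    refine Finset.sum_lt_sum (fun i _ => hle i) ⟨i, Finset.mem_univ i, ?_⟩
    by_cases h1 : i ∈ B <;> by_cases h2 : i ∈ B' <;> simp_all [vec]
  have hconv : Convex ℝ {x | l x < l (vec B)} := convex_halfSpace_lt l.isLinear _
  have hlt : l (vec B) < l (vec B) := convexHull_min hsub hconv h
  exact lt_irrefl _ hlt

theorem basePolytope_injective (E : Type*) [Finite E] :
    Function.Injective fun M : MatroidOn E => basePolytope M.1 := by
  intro M N h
  apply Subtype.ext
  apply Matroid.ext_isBase (M.2.trans N.2.symm)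
  intro B _
  have h' : basePolytope M.1 = basePolytope N.1 := h
  rw [← vec_mem_basePolytope_iff, ← vec_mem_basePolytope_iff, h']

/-- The identification of a matroid on the finite set `E` with its base polytope. -/
def polytopeEquiv (E : Type*) [Finite E] : MatroidOn E ≃ matroidPolytopes E :=
  Equiv.ofInjective _ (basePolytope_injective E)

/-- The rank of a set in a matroid, as a natural number (it is finite if `E` is finite). -/
def rk {E : Type*} (M : Matroid E) (X : Set E) : ℕ := (M.eRk X).toNat

open Classical in
/-- The map `𝔐_E → ℚ` with value `1` if all `F_i` are flats of the matroid, else `0`. -/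
def flagFlats {E : Type*} [Finite E] {m : ℕ} (F : Fin (m + 1) → Set E)
    (P : matroidPolytopes E) : ℚ :=
  if ∀ i, ((polytopeEquiv E).symm P).1.IsFlat (F i) then 1 else 0

open Classical in
/-- The map `𝔐_E → ℚ` with value `1` if all `F_i` are flats of the matroid and
`rk F_i = r_i` for all `i`, else `0`. -/
def flagFlatsRank {E : Type*} [Finite E] {m : ℕ} (F : Fin (m + 1) → Set E)
    (r : Fin (m + 1) → ℤ) (P : matroidPolytopes E) : ℚ :=
  if ∀ i, ((polytopeEquiv E).symm P).1.IsFlat (F i) ∧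
      (rk ((polytopeEquiv E).symm P).1 (F i) : ℤ) = r i then 1 else 0

end MatroidValuation

end

/-!
The Euler characteristic respects linear relations between indicator functions of compact convex
sets, so "`𝒫(M)` meets a given closed convex set" is valuative. For a chain of sets `X_k`, some
basis of `M` meets every `X_k` in a basis of `X_k`; hence `rk X_k ≥ q_k` for all `k` exactly if
`𝒫(M)` meets the intersection of the half-spaces `∑_{e ∈ X_k} x_e ≥ q_k`, and prescribing the ranks
along a chain is valuative. Finally, every `F_i` is a flat exactly if no element of
`(⋂_{j > i} F_j) \ F_i` lies in the closure of `F_i`. Inclusion–exclusion over subsets `T_i` of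
these differences expresses this by the conditions `rk (F_i ∪ T_i) = rk F_i`, in which all the sets
`F_i` and `F_i ∪ T_i` form a chain.
-/

open Filter Topology

namespace MatroidValuation

section EulerCharacteristic

variable {ι A : Type*} [AddCommGroup A] {s : Finset ι} {a : ι → A}

open Classical in
/-- Additivity of the Euler characteristic on `V` for the coefficients `a i`, `i ∈ s`: a linear
relation `∑ a i • 1_{K i} = 0` between indicator functions of compact convex sets is inherited by
their Euler characteristics, which are `1` for nonempty sets and `0` for `∅`. The coefficients are
parameters because induction on the dimension of `V` does not change them. -/
def IsEulerAdditive (s : Finset ι) (a : ι → A) (V : Type*) [TopologicalSpace V] [AddCommGroup V]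
    [Module ℝ V] : Prop :=
  ∀ K : ι → Set V, (∀ i, IsCompact (K i)) → (∀ i, Convex ℝ (K i)) →
    (∀ x, ∑ i ∈ s with x ∈ K i, a i = 0) → ∑ i ∈ s with (K i).Nonempty, a i = 0

theorem eventually_nhdsGT_mem_iff {α : Type*} [LinearOrder α] [TopologicalSpace α]
    [OrderTopology α] {J : Set α} (hJ : IsClosed J) (hconn : J.OrdConnected) (t : α) :
    ∀ᶠ x in 𝓝[>] t, x ∈ J ↔ t ∈ J ∧ ¬ IsGreatest J t := by
  by_cases ht : t ∈ J
  · by_cases hmax : IsGreatest J t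
    · filter_upwards [self_mem_nhdsWithin] with x hx
      have hxJ : x ∉ J := fun h => (hmax.2 h).not_gt hx
      simp only [hxJ, hmax, not_true, and_false]
    · obtain ⟨u, huJ, htu⟩ : ∃ u ∈ J, t < u := by
        simpa [IsGreatest, ht, upperBounds] using hmax
      filter_upwards [Ioo_mem_nhdsGT htu] with x hx
      simp only [hconn.out ht huJ ⟨hx.1.le, hx.2.le⟩, ht, hmax, not_false_iff, and_self]
  · filter_upwards [nhdsWithin_le_nhds (hJ.isOpen_compl.mem_nhds ht)] with x hx
    exact iff_of_false hx fun h => ht h.1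

theorem isEulerAdditive_real : IsEulerAdditive s a ℝ := by
  classical
  intro J hc hv hrel
  -- The sets that disappear just to the right of `t` are those with greatest element `t`.
  have sum_isGreatest : ∀ t, ∑ i ∈ s with IsGreatest (J i) t, a i = 0 := fun t => by
    obtain ⟨x, hx⟩ := ((eventually_all_finset s).2 fun i _ =>
      eventually_nhdsGT_mem_iff (hc i).isClosed (hv i).ordConnected t).exists
    have hsplit := Finset.sum_filter_add_sum_filter_not {i ∈ s | t ∈ J i}
      (fun i => IsGreatest (J i) t) a
    rw [hrel t, Finset.filter_filter, Finset.filter_filter,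
      ← Finset.filter_congr hx, hrel x, add_zero] at hsplit
    rw [← hsplit]
    exact Finset.sum_congr (Finset.filter_congr fun i _ => ⟨fun h => ⟨h.1, h⟩, And.right⟩)
      fun _ _ => rfl
  have isGreatest_iff : ∀ i t, (J i).Nonempty ∧ sSup (J i) = t ↔ IsGreatest (J i) t := fun i t =>
    ⟨fun ⟨hne, ht⟩ => ht ▸ (hc i).isGreatest_sSup hne, fun h => ⟨h.nonempty, h.csSup_eq⟩⟩
  rw [← Finset.sum_fiberwise_of_maps_to fun i hi =>
    Finset.mem_image_of_mem (fun i => sSup (J i)) hi]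
  refine Finset.sum_eq_zero fun t _ => ?_
  simpa only [Finset.filter_filter, isGreatest_iff] using sum_isGreatest t

variable {V W : Type*} [TopologicalSpace V] [AddCommGroup V] [Module ℝ V]
  [TopologicalSpace W] [AddCommGroup W] [Module ℝ W]

theorem isEulerAdditive_of_subsingleton [Subsingleton V] : IsEulerAdditive s a V := by
  classical
  intro K _ _ hrel
  simpa only [Set.nonempty_def, Subsingleton.elim _ (0 : V), exists_const] using hrel 0

theorem IsEulerAdditive.of_equiv (hV : IsEulerAdditive s a V) (e : V ≃L[ℝ] W) :
    IsEulerAdditive s a W := by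
  classical
  intro K hc hv hrel
  have := hV (fun i => e ⁻¹' K i) (fun i => e.toHomeomorph.isCompact_preimage.2 (hc i))
    (fun i => (hv i).linear_preimage e.toLinearMap) fun x => hrel (e x)
  simpa only [e.surjective.nonempty_preimage] using this

/-- The relation restricts to the fibres of `V × W → W`; additivity on the fibres turns it into
a relation between the projections to `W`. -/
theorem IsEulerAdditive.prod [T1Space W] (hV : IsEulerAdditive s a V)
    (hW : IsEulerAdditive s a W) : IsEulerAdditive s a (V × W) := by
  classical
  intro K hc hv hrel
  have hproj := hW (fun i => Prod.snd '' K i) (fun i => (hc i).image continuous_snd)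
    (fun i => (hv i).linear_image (.snd ℝ V W)) fun w => by
      have hfibre := hV (fun i => Prod.fst '' (K i ∩ Prod.snd ⁻¹' {w}))
        (fun i => ((hc i).inter_right (isClosed_singleton.preimage continuous_snd)).image
          continuous_fst)
        (fun i => ((hv i).inter ((convex_singleton w).linear_preimage (.snd ℝ V W))).linear_image
          (.fst ℝ V W))
        fun v => by simpa using hrel (v, w)
      simpa [Set.Nonempty] using hfibre
  simpa only [Set.image_nonempty] using hproj

theorem isEulerAdditive_of_finiteDimensional [IsTopologicalAddGroup V] [ContinuousSMul ℝ V]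
    [T2Space V] [FiniteDimensional ℝ V] : IsEulerAdditive s a V := by
  have hpi : ∀ n, IsEulerAdditive s a (Fin n → ℝ) := fun n => by
    induction n with
    | zero => exact isEulerAdditive_of_subsingleton
    | succ n ih => exact (isEulerAdditive_real.prod ih).of_equiv (Fin.consEquivL ℝ fun _ => ℝ)
  exact (hpi (Module.finrank ℝ V)).of_equiv (.ofFinrankEq (Module.finrank_fin_fun ℝ))

end EulerCharacteristic

section Valuations

variable {E A B : Type*} [AddCommGroup A] [AddCommGroup B] {𝔓 : Set (Set (E → ℝ))}

theorem IsValuation.map {f : 𝔓 → A} (hf : IsValuation 𝔓 f) (φ : A →+ B) :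
    IsValuation 𝔓 fun P => φ (f P) := by
  obtain ⟨g, hg⟩ := hf
  exact ⟨φ.comp g, fun P => congrArg φ (hg P)⟩

theorem IsValuation.sum_zsmul {κ : Type*} {s : Finset κ} {f : κ → 𝔓 → A}
    (hf : ∀ k ∈ s, IsValuation 𝔓 (f k)) (c : κ → ℤ) :
    IsValuation 𝔓 fun P => ∑ k ∈ s, c k • f k P := by
  choose! g hg using hf
  refine ⟨∑ k ∈ s, c k • g k, fun P => ?_⟩
  rw [AddMonoidHom.finsetSum_apply]
  exact Finset.sum_congr rfl fun k hk => congrArg (c k • ·) (hg k hk P)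

open Classical in
theorem linearCombination_toIndicator_apply (c : 𝔓 →₀ ℤ) (x : E → ℝ) :
    (Finsupp.linearCombination ℤ (toIndicator 𝔓) c).1 x =
      ∑ P ∈ c.support with x ∈ P.1, c P := by
  simp [Finsupp.linearCombination_apply, Finsupp.sum, toIndicator, indicatorFun,
    Set.indicator_apply, Finset.sum_filter]

theorem linearCombination_toIndicator_surjective :
    Function.Surjective (Finsupp.linearCombination ℤ (toIndicator 𝔓)) := by
  have hrange : Set.range (toIndicator 𝔓) =
      ((↑) : indicatorSubgroup 𝔓 → _) ⁻¹' (indicatorFun '' 𝔓) := by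
    ext y
    simp [toIndicator, Subtype.ext_iff]
  rw [← LinearMap.range_eq_top, Finsupp.range_linearCombination, ← Submodule.toAddSubgroup_inj,
    Submodule.span_int_eq_addSubgroupClosure, hrange]
  exact AddSubgroup.closure_closure_coe_preimage

open Classical in
theorem IsValuation.of_relations {f : 𝔓 → A}
    (hf : ∀ (s : Finset 𝔓) (a : 𝔓 → ℤ),
      (∀ x, ∑ P ∈ s with x ∈ P.1, a P = 0) → ∑ P ∈ s, a P • f P = 0) : IsValuation 𝔓 f := by
  let Φ := (Finsupp.linearCombination ℤ (toIndicator 𝔓)).toAddMonoidHom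
  let Ψ := (Finsupp.linearCombination ℤ f).toAddMonoidHom
  have hker : Φ.ker ≤ Ψ.ker := fun c hc => hf c.support c fun x => by
    rw [← linearCombination_toIndicator_apply]
    exact congrFun (congrArg Subtype.val hc) x
  refine ⟨Φ.liftOfSurjective linearCombination_toIndicator_surjective ⟨Ψ, hker⟩, fun P => ?_⟩
  have hΦ : Φ (.single P 1) = toIndicator 𝔓 P := by simp [Φ]
  rw [← hΦ, AddMonoidHom.liftOfRightInverse_comp_apply]
  simp [Ψ]

open Classical in
theorem isValuation_inter_nonempty [Finite E] (hc : ∀ P ∈ 𝔓, IsCompact P)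
    (hv : ∀ P ∈ 𝔓, Convex ℝ P) {H : Set (E → ℝ)} (hH : IsClosed H) (hHv : Convex ℝ H) :
    IsValuation 𝔓 fun P => if (P.1 ∩ H).Nonempty then (1 : ℤ) else 0 := by
  have := Fintype.ofFinite E
  refine .of_relations fun s a hrel => ?_
  have heuler := isEulerAdditive_of_finiteDimensional (s := s) (a := a) (fun P => P.1 ∩ H)
    (fun P => (hc P.1 P.2).inter_right hH) (fun P => (hv P.1 P.2).inter hHv) fun x => by
      by_cases hx : x ∈ H
      · simpa [hx] using hrel x
      · simp [hx]
  simpa [Finset.sum_filter] using heuler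

end Valuations

section Rank

variable {E : Type*} {M : Matroid E}

theorem rk_eq_ncard_of_isBasis {I X : Set E} (hI : M.IsBasis I X) : rk M X = I.ncard := by
  rw [rk, hI.eRk_eq_encard, Set.ncard]

theorem exists_isBase_forall_isBasis_inter {𝒞 : Set (Set E)} (hfin : 𝒞.Finite)
    (hchain : IsChain (· ⊆ ·) 𝒞) (hground : ∀ X ∈ 𝒞, X ⊆ M.E) :
    ∃ B, M.IsBase B ∧ ∀ X ∈ 𝒞, M.IsBasis (B ∩ X) X := by
  classical
  lift 𝒞 to Finset (Set E) using hfin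
  induction 𝒞 using Finset.strongInduction with
  | H 𝒞 ih =>
    obtain rfl | hne := 𝒞.eq_empty_or_nonempty
    · simpa using M.exists_isBase
    obtain ⟨Z, hZ⟩ := 𝒞.exists_maximal hne
    have hlargest : ∀ X ∈ 𝒞, X ⊆ Z := fun X hX =>
      (hchain.total hX hZ.prop).elim id fun h => hZ.le_of_ge hX h
    obtain ⟨B₀, hB₀, hbasis₀⟩ := ih (𝒞.erase Z) (Finset.erase_ssubset hZ.prop)
      (hchain.mono (by simp)) fun X hX => hground X (Finset.mem_of_mem_erase hX)
    obtain ⟨I, hI, hB₀I⟩ := (hB₀.indep.inter_right Z).subset_isBasis_of_subset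
      Set.inter_subset_right (hground Z hZ.prop)
    obtain ⟨B, hB, hIB⟩ := hI.indep.exists_isBase_superset
    have extend : ∀ {J X}, M.IsBasis J X → J ⊆ B → M.IsBasis (B ∩ X) X := fun {J X} hJ hJB => by
      rwa [← hJ.eq_of_subset_indep (hB.indep.inter_right X) (Set.subset_inter hJB hJ.subset)
        Set.inter_subset_right]
    refine ⟨B, hB, fun X hX => ?_⟩
    obtain rfl | hXZ := eq_or_ne X Z
    · exact extend hI hIB
    · refine extend (hbasis₀ X (Finset.mem_erase.2 ⟨hXZ, hX⟩)) ?_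
      exact (Set.inter_subset_inter_right B₀ (hlargest X hX)).trans (hB₀I.trans hIB)

variable [Finite E]

theorem natCast_rk (M : Matroid E) (X : Set E) : (rk M X : ℕ∞) = M.eRk X :=
  ENat.natCast_toNat (M.isRkFinite_set X).eRk_lt_top.ne

theorem ncard_le_rk_of_indep {I X : Set E} (hI : M.Indep I) (hIX : I ⊆ X) : I.ncard ≤ rk M X := by
  rw [← Nat.cast_le (α := ℕ∞), natCast_rk, I.toFinite.cast_ncard_eq]
  exact hI.encard_le_eRk_of_subset hIX

theorem rk_le_ncard (M : Matroid E) (X : Set E) : rk M X ≤ X.ncard := by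
  rw [← Nat.cast_le (α := ℕ∞), natCast_rk, X.toFinite.cast_ncard_eq]
  exact M.eRk_le_encard X

theorem rk_union_eq_iff_subset_closure {X T : Set E} (hX : X ⊆ M.E) (hT : T ⊆ M.E) :
    rk M (X ∪ T) = rk M X ↔ T ⊆ M.closure X := by
  rw [← Nat.cast_inj (R := ℕ∞), natCast_rk, natCast_rk]
  constructor
  · intro h
    rw [(M.isRkFinite_set X).closure_eq_closure_of_subset_of_eRk_ge_eRk
      Set.subset_union_left h.le]
    exact Set.subset_union_right.trans (M.subset_closure _ (Set.union_subset hX hT))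
  · intro h
    refine le_antisymm ?_ (M.eRk_mono Set.subset_union_left)
    rw [← M.eRk_closure_eq X]
    exact M.eRk_mono (Set.union_subset (M.subset_closure X hX) h)

end Rank

section BasePolytope

theorem isCompact_basePolytope {E : Type*} [Finite E] (M : Matroid E) :
    IsCompact (basePolytope M) :=
  (Set.toFinite _).isCompact_convexHull ℝ

variable {E : Type*} [Fintype E] {M : Matroid E}

theorem vec_dotProduct_vec (X B : Set E) : vec X ⬝ᵥ vec B = (B ∩ X).ncard := by
  classical
  have hmul : ∀ i, vec X i * vec B i = if i ∈ B ∩ X then 1 else 0 := fun i => by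
    simp [vec, Set.indicator_apply, ite_and]
  simp only [dotProduct, hmul, Finset.sum_boole, Set.ncard_eq_toFinset_card',
    Set.filter_mem_univ_eq_toFinset]

theorem isLinearMap_dotProduct (v : E → ℝ) : IsLinearMap ℝ fun x => v ⬝ᵥ x :=
  ⟨dotProduct_add v, fun c => dotProduct_smul c v⟩

theorem vec_dotProduct_le_rk {x : E → ℝ} (hx : x ∈ basePolytope M) (X : Set E) :
    vec X ⬝ᵥ x ≤ rk M X := by
  refine convexHull_min (t := {x | vec X ⬝ᵥ x ≤ rk M X}) ?_
    (convex_halfSpace_le (isLinearMap_dotProduct _) _) hx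
  rintro _ ⟨B, hB, rfl⟩
  rw [Set.mem_ofPred_eq, vec_dotProduct_vec, Nat.cast_le]
  exact ncard_le_rk_of_indep (hB.indep.inter_right X) Set.inter_subset_right

theorem basePolytope_inter_nonempty_iff {κ : Type*} [Finite κ] {X : κ → Set E}
    (hX : IsChain (· ⊆ ·) (Set.range X)) (hground : ∀ k, X k ⊆ M.E) (q : κ → ℝ) :
    (basePolytope M ∩ ⋂ k, {x | q k ≤ vec (X k) ⬝ᵥ x}).Nonempty ↔ ∀ k, q k ≤ rk M (X k) := by
  constructor
  · rintro ⟨x, hx, hq⟩ k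
    exact (Set.mem_iInter.1 hq k).trans (vec_dotProduct_le_rk hx (X k))
  · intro hq
    obtain ⟨B, hB, hbasis⟩ := exists_isBase_forall_isBasis_inter (Set.finite_range X) hX
      (Set.forall_mem_range.2 hground)
    refine ⟨vec B, (vec_mem_basePolytope_iff M B).2 hB, Set.mem_iInter.2 fun k => ?_⟩
    rw [Set.mem_ofPred_eq, vec_dotProduct_vec, ← rk_eq_ncard_of_isBasis (hbasis _ ⟨k, rfl⟩)]
    exact hq k

end BasePolytope

section Flats

theorem forall_isFlat_iff_disjoint_closure {E ι : Type*} [Preorder ι] [WellFoundedGT ι]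
    {M : Matroid E} {F : ι → Set E} (hground : ∀ i, F i ⊆ M.E) (hF : Monotone F) :
    (∀ i, M.IsFlat (F i)) ↔ ∀ i, Disjoint ((⋂ j > i, F j) \ F i) (M.closure (F i)) := by
  constructor
  · intro h i
    rw [(h i).closure]
    exact Set.disjoint_sdiff_left
  · intro h i
    induction i using WellFoundedGT.induction with
    | ind i ih =>
      have hlater : M.closure (F i) ⊆ ⋂ j > i, F j := Set.subset_iInter₂ fun j hj => by
        rw [← (ih j hj).closure]
        exact M.closure_subset_closure (hF hj.le)
      rw [Matroid.isFlat_iff_closure_eq]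
      refine Set.Subset.antisymm (fun x hx => ?_) (M.subset_closure _ (hground i))
      by_contra hxF
      exact Set.disjoint_left.1 (h i) ⟨hlater hx, hxF⟩ hx

open Classical in
theorem sum_powerset_neg_one_pow_card_mul_ite_subset {α : Type*} (S : Finset α) (C : Set α) :
    ∑ T ∈ S.powerset, (-1 : ℤ) ^ T.card * (if (T : Set α) ⊆ C then 1 else 0) =
      if Disjoint (S : Set α) C then 1 else 0 := by
  have hfilter : S.powerset.filter (fun T : Finset α => (T : Set α) ⊆ C) =
      Finset.powerset {x ∈ S | x ∈ C} := by
    ext T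
    simp [Finset.subset_iff, Set.subset_def, forall_and]
  simp only [mul_ite, mul_one, mul_zero, ← Finset.sum_filter, hfilter,
    Finset.sum_powerset_neg_one_pow_card, Finset.filter_eq_empty_iff, Set.disjoint_left,
    Finset.mem_coe]

theorem isChain_range_sumElim {α ι : Type*} [Preorder α] [LinearOrder ι] {F G : ι → α}
    (hF : Monotone F) (hFG : ∀ i, F i ≤ G i) (hGF : ∀ i j, i < j → G i ≤ F j) :
    IsChain (· ≤ ·) (Set.range (Sum.elim F G)) := by
  rintro _ ⟨i | i, rfl⟩ _ ⟨j | j, rfl⟩ -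
  · exact (le_total i j).imp (@hF i j) (@hF j i)
  · exact (le_or_gt i j).imp (fun h => (hF h).trans (hFG j)) (hGF j i)
  · exact (lt_or_ge i j).imp (hGF i j) fun h => (hF h).trans (hFG i)
  · rcases lt_trichotomy i j with h | rfl | h
    · exact .inl ((hGF i j h).trans (hFG j))
    · exact .inl le_rfl
    · exact .inr ((hGF j i h).trans (hFG i))

end Flats

section Valuative

variable {E : Type*} [Finite E]

open Classical in
/-- A class of matroids on `E` is valuative if its indicator function `MatroidOn E → ℤ`,
transported to base polytopes, is a valuation. -/
def IsValuative (p : MatroidOn E → Prop) : Prop :=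
  IsValuation (matroidPolytopes E) fun P => if p ((polytopeEquiv E).symm P) then (1 : ℤ) else 0

open Classical in
theorem IsValuative.isValuation_ite {p : MatroidOn E → Prop} (hp : IsValuative p) {A : Type*}
    [AddCommGroup A] (a : A) :
    IsValuation (matroidPolytopes E) fun P => if p ((polytopeEquiv E).symm P) then a else 0 := by
  simpa [apply_ite] using IsValuation.map hp (zmultiplesHom A a)

open Classical in
/-- If the indicator function of each `p i` expands into those of `q i t`, then that of the
conjunction expands, by multiplying out, into those of the conjunctions `⋀ i, q i (t i)`. -/
theorem IsValuative.forall_of_ite_eq_sum {ι τ : Type*} [Fintype ι] {s : ι → Finset τ}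
    {c : ι → τ → ℤ} {p : ι → MatroidOn E → Prop} {q : ι → τ → MatroidOn E → Prop}
    (hpq : ∀ i M, (if p i M then (1 : ℤ) else 0) = ∑ t ∈ s i, c i t * if q i t M then 1 else 0)
    (hq : ∀ t ∈ Fintype.piFinset s, IsValuative fun M => ∀ i, q i (t i) M) :
    IsValuative fun M => ∀ i, p i M := by
  classical
  have expand : ∀ M, (if ∀ i, p i M then (1 : ℤ) else 0) =
      ∑ t ∈ Fintype.piFinset s, (∏ i, c i (t i)) • if ∀ i, q i (t i) M then (1 : ℤ) else 0 :=
    fun M => calc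
      _ = ∏ i, if p i M then (1 : ℤ) else 0 := by simp [Finset.prod_boole]
      _ = ∏ i, ∑ t ∈ s i, c i t * if q i t M then 1 else 0 :=
        Finset.prod_congr rfl fun i _ => hpq i M
      _ = ∑ t ∈ Fintype.piFinset s, ∏ i, c i (t i) * if q i (t i) M then 1 else 0 :=
        Finset.prod_univ_sum s _
      _ = _ := Finset.sum_congr rfl fun t _ => by
        simp only [Finset.prod_mul_distrib, Finset.prod_boole, Finset.mem_univ, true_imp_iff,
          smul_eq_mul]
  unfold IsValuative
  convert IsValuation.sum_zsmul hq fun t => ∏ i, c i (t i) using 2 with P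
  convert expand ((polytopeEquiv E).symm P)

variable {κ : Type*} [Finite κ] {X : κ → Set E}

theorem isValuative_forall_le_rk (hX : IsChain (· ⊆ ·) (Set.range X)) (q : κ → ℤ) :
    IsValuative fun M : MatroidOn E => ∀ k, q k ≤ rk M.1 (X k) := by
  classical
  have := Fintype.ofFinite E
  have hclosed : IsClosed (⋂ k, {x | (q k : ℝ) ≤ vec (X k) ⬝ᵥ x}) :=
    isClosed_iInter fun k => isClosed_le continuous_const (by unfold dotProduct; fun_prop)
  have hconvex : Convex ℝ (⋂ k, {x | (q k : ℝ) ≤ vec (X k) ⬝ᵥ x}) :=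
    convex_iInter fun k => convex_halfSpace_ge (isLinearMap_dotProduct _) _
  have hmeets : ∀ P : matroidPolytopes E, (∀ k, q k ≤ rk ((polytopeEquiv E).symm P).1 (X k)) ↔
      (P.1 ∩ ⋂ k, {x | (q k : ℝ) ≤ vec (X k) ⬝ᵥ x}).Nonempty := fun P => by
    obtain ⟨M, rfl⟩ := (polytopeEquiv E).surjective P
    have hM : (polytopeEquiv E M).1 = basePolytope M.1 := rfl
    rw [Equiv.symm_apply_apply, hM, basePolytope_inter_nonempty_iff hX (by simp [M.2])]
    norm_cast
  simp only [IsValuative, hmeets]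
  refine isValuation_inter_nonempty ?_ ?_ hclosed hconvex
  · rintro _ ⟨M, rfl⟩
    exact isCompact_basePolytope M.1
  · rintro _ ⟨M, rfl⟩
    exact convex_convexHull ℝ _

theorem isValuative_forall_rk_eq (hX : IsChain (· ⊆ ·) (Set.range X)) (q : κ → ℤ) :
    IsValuative fun M : MatroidOn E => ∀ k, (rk M.1 (X k) : ℤ) = q k := by
  have := Fintype.ofFinite κ
  refine .forall_of_ite_eq_sum (s := fun _ => {0, 1}) (c := fun _ ε => 1 - 2 * ε)
    (q := fun k ε M => q k + ε ≤ rk M.1 (X k)) (fun k M => ?_)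
    fun ε _ => isValuative_forall_le_rk hX fun k => q k + ε k
  rw [Finset.sum_pair zero_ne_one]
  grind

variable {ι : Type*} [LinearOrder ι] [Finite ι] {F : ι → Set E}

theorem isValuative_forall_isFlat_and_rk_eq (hF : Monotone F) (r : ι → ℤ) :
    IsValuative fun M : MatroidOn E => ∀ i, M.1.IsFlat (F i) ∧ (rk M.1 (F i) : ℤ) = r i := by
  classical
  have := Fintype.ofFinite ι
  let S : ι → Finset E := fun i => ((⋂ j > i, F j) \ F i).toFinite.toFinset
  have hflat : ∀ M : MatroidOn E, (∀ i, M.1.IsFlat (F i) ∧ (rk M.1 (F i) : ℤ) = r i) ↔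
      ∀ i, Disjoint (S i : Set E) (M.1.closure (F i)) ∧ (rk M.1 (F i) : ℤ) = r i := fun M => by
    simp only [forall_and, forall_isFlat_iff_disjoint_closure (M := M.1) (by simp [M.2]) hF, S,
      Set.Finite.coe_toFinset]
  simp only [hflat]
  refine .forall_of_ite_eq_sum (s := fun i => (S i).powerset) (c := fun _ T => (-1) ^ T.card)
    (q := fun i T M => (rk M.1 (F i) : ℤ) = r i ∧ (rk M.1 (F i ∪ T) : ℤ) = r i)
    (fun i M => ?_) fun T hT => ?_
  · by_cases hr : (rk M.1 (F i) : ℤ) = r i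
    · have hrk : ∀ T : Set E, (rk M.1 (F i ∪ T) : ℤ) = r i ↔ T ⊆ M.1.closure (F i) := fun T => by
        rw [← hr, Nat.cast_inj, rk_union_eq_iff_subset_closure (by simp [M.2]) (by simp [M.2])]
      simp only [hr, hrk, true_and, and_true, sum_powerset_neg_one_pow_card_mul_ite_subset]
    · simp [hr]
  · have hT' : ∀ i, (T i : Set E) ⊆ (⋂ j > i, F j) \ F i := by simpa [S] using hT
    have hchain := isChain_range_sumElim hF (G := fun i => F i ∪ T i)
      (fun i => Set.subset_union_left) fun i j hij => Set.union_subset (hF hij.le)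
        ((hT' i).trans (Set.sdiff_subset.trans (Set.iInter₂_subset j hij)))
    simpa only [Sum.forall, Sum.elim_inl, Sum.elim_inr, forall_and] using
      isValuative_forall_rk_eq hchain (Sum.elim r r)

theorem isValuative_forall_isFlat (hF : Monotone F) :
    IsValuative fun M : MatroidOn E => ∀ i, M.1.IsFlat (F i) := by
  have := Fintype.ofFinite ι
  refine .forall_of_ite_eq_sum (s := fun i => Finset.range ((F i).ncard + 1)) (c := fun _ _ => 1)
    (q := fun i r M => M.1.IsFlat (F i) ∧ (rk M.1 (F i) : ℤ) = r) (fun i M => ?_)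
    fun r _ => isValuative_forall_isFlat_and_rk_eq hF fun i => (r i : ℤ)
  by_cases hi : M.1.IsFlat (F i)
  · simp [hi, rk_le_ncard]
  · simp [hi]

end Valuative

end MatroidValuation

open Classical MatroidValuation in
theorem theorem8p5_general {E : Type*} [Finite E] {ι : Type*} [LinearOrder ι] [Finite ι]
    {F : ι → Set E} (hF : Monotone F) {A : Type*} [AddCommGroup A] (a : A) :
    IsValuation (matroidPolytopes E)
        (fun P => if ∀ i, ((polytopeEquiv E).symm P).1.IsFlat (F i) then a else 0) ∧
      ∀ r : ι → ℤ, IsValuation (matroidPolytopes E) (fun P =>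
        if ∀ i, ((polytopeEquiv E).symm P).1.IsFlat (F i) ∧
          (rk ((polytopeEquiv E).symm P).1 (F i) : ℤ) = r i then a else 0) :=
  ⟨(isValuative_forall_isFlat hF).isValuation_ite a,
    fun r => (isValuative_forall_isFlat_and_rk_eq hF r).isValuation_ite a⟩

theorem theorem8p5 {E : Type*} [Finite E] (m : ℕ) (F : Fin (m + 1) → Set E)
    (hF : StrictMono F) (hE : F (Fin.last m) ⊂ Set.univ) :
    MatroidValuation.IsValuation (MatroidValuation.matroidPolytopes E)
        (MatroidValuation.flagFlats F) ∧
      ∀ r : Fin (m + 1) → ℤ,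
        MatroidValuation.IsValuation (MatroidValuation.matroidPolytopes E)
          (MatroidValuation.flagFlatsRank F r) := by
  unfold MatroidValuation.flagFlats MatroidValuation.flagFlatsRank
  convert theorem8p5_general hF.monotone (1 : ℚ)
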